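/- **Setting.** Let $\mathcal{L}$ be a first-order language expanding the language of groups. Let $\mathcal{L}^+$ be the two-sorted language obtained from $\mathcal{L}$ by adding a sort $\mathcal{I}$ with a binary relation $<$ and a binary function $d$ on it and, for every $\mathcal{L}$-formula $\theta(\bar x;\bar y)$, a function symbol $\mu_\theta(\bar y)$ from the home sort to $\mathcal{I}$. A finite $\mathcal{L}$-structure $A$ is canonically an $\mathcal{L}^+$-structure: $\mathcal{I}$ is $[0,1]$ with its usual order and distance, and $\mu_\theta(\bar b)=|\theta(A^{\bar x};\bar b)|/|A|^{|\bar x|}$. Let $(A_i)_{i\in I}$ be finite $\mathcal{L}$-structures expanding groups, let $\mathcal{U}$ be an ultrafilter on $I$, and let $G$ be (the home sort of) an $\mathcal{L}^+$-elementary extension of $\prod_{\mathcal U}A_i$. The pseudofinite counting measure is defined by $\mu(\theta(\bar x;\bar b))=\operatorname{st}(\mu_\theta(\bar b))\in[0,1]$, the standard part of $\mu_\theta(\bar b)$. Formulas are $\mathcal{L}$-formulas with parameters from $G$. For a formula $\phi(x)$ in one variable of the home sort, put $\phi^{\ell}(x;y)=\phi(y\cdot x)$, $\phi^{r}(x;y)=\phi(x\cdot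 y)$, and for $\epsilon\ge 0$ $$\operatorname{Stab}^{\epsilon}_\mu(\phi)=\{g\in G:\mu(\phi(g^{-1}x)\,\triangle\,\phi(x))\le\epsilon\},\qquad \operatorname{Stab}_\mu(\phi)=\operatorname{Stab}^{0}_\mu(\phi).$$ A formula $\delta(x;y)$ is *NIP* if for some $k\ge1$ there are no $(a_i)_{i\in[k]}$ and $(b_X)_{X\subseteq[k]}$ in $G$ such that $\delta(a_i;b_X)$ holds if and only if $i\in X$. A set $X\subseteq G$ is *left generic* if finitely many left translates of $X$ cover $G$. It is *$\delta$-type-definable over* $B\subseteq G$ if it is an intersection of sets each of which is defined by a finite Boolean combination of formulas $\delta(x;b)$ with $b\in B$. **Statement.** Let $\phi(x)$ be a formula such that $\phi^{\ell}(x;y)$ is NIP. Then: 1. For every real $\epsilon>0$, $\operatorname{Stab}^{\epsilon}_\mu(\phi)$ is left generic, and it is $\phi^{r}$-type-definable over a countable subset of $G$. 2. $\operatorname{Stab}_\mu(\phi)$ is a subgroup of $G$ of index at most $2^{\aleph_0}$ (so of bounded index, i.e. of index less than $\kappa$, if $G$ is $\kappa$-saturated with $\kappa>2^{\aleph_0}$),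 and it is $\phi^{r}$-type-definable over a countable subset of $G$. -/

import Mathlib

open FirstOrder FirstOrder.Language

open scoped Pointwise Cardinal

universe u v

noncomputable section

namespace PseudofiniteGroup

/-! ### Languages expanding the language of groups -/

/-- `L` expands the language of groups. -/
class GroupLanguage (L : FirstOrder.Language.{u, v}) where
  mulSym : L.Functions 2
  oneSym : L.Functions 0
  invSym : L.Functions 1

/-- The group symbols of `L` are interpreted in `G` by its group operations. -/
class CompatibleGroup (L : FirstOrder.Language.{u, v}) [GroupLanguage L] (G : Type*) [L.Structure G]
    [Group G] : Prop where
  funMap_mul : ∀ x : Fin 2 → G,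
    Structure.funMap (GroupLanguage.mulSym : L.Functions 2) x = x 0 * x 1
  funMap_one : ∀ x : Fin 0 → G, Structure.funMap (GroupLanguage.oneSym : L.Functions 0) x = 1
  funMap_inv : ∀ x : Fin 1 → G,
    Structure.funMap (GroupLanguage.invSym : L.Functions 1) x = (x 0)⁻¹

/-! ### The two-sorted language `L⁺`

`L⁺` adds to `L` a sort `I` with a binary relation `<`, a binary function `d`, and, for each
`L`-formula `φ(x₁,…,x_m; y₁,…,y_n)`, an `n`-ary function symbol `μ_φ` from the home sort to `I`.
A two-sorted structure with home sort `G` and second sort `J` is coded as a one-sorted structure on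
the disjoint union `G ⊕ J`, with a predicate `home` for the home sort. -/

/-- The function symbols of `L⁺`. -/
inductive PlusFunctions (L : FirstOrder.Language.{u, v}) : ℕ → Type (max u v)
  | base {n : ℕ} (f : L.Functions n) : PlusFunctions L n
  | dist : PlusFunctions L 2
  | mu {m n : ℕ} (φ : L.Formula (Fin m ⊕ Fin n)) : PlusFunctions L n

/-- The relation symbols of `L⁺`. -/
inductive PlusRelations (L : FirstOrder.Language.{u, v}) : ℕ → Type v
  | base {n : ℕ} (R : L.Relations n) : PlusRelations L n
  | home : PlusRelations L 1
  | lt : PlusRelations L 2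

/-- The language `L⁺`. -/
def plus (L : FirstOrder.Language.{u, v}) : FirstOrder.Language.{max u v, v} :=
  ⟨PlusFunctions L, PlusRelations L⟩

/-- An expansion of the `L`-structure `G` to a two-sorted `L⁺`-structure with second sort `J`:
interpretations of the new symbols. -/
class SecondSort (L : FirstOrder.Language.{u, v}) (G : Type*) [L.Structure G] (J : Type*) where
  lt : J → J → Prop
  dist : J → J → J
  mu : ∀ {m n : ℕ}, L.Formula (Fin m ⊕ Fin n) → (Fin n → G) → J

open Classical in
/-- Extend an operation `f` from tuples of the sort `i : α → M` to all tuples of `M`; a tuple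
that is not of this sort (so has positive length) is sent to its first entry. -/
def extendSort {α M : Type*} {n : ℕ} (i : α → M) (f : (Fin n → α) → M) (x : Fin n → M) : M :=
  if h : ∃ a : Fin n → α, x = i ∘ a then f h.choose
  else x ⟨0, Nat.pos_of_ne_zero (by
    rintro rfl
    exact h ⟨Fin.elim0, Subsingleton.elim _ _⟩)⟩

/-- The one-sorted coding on `G ⊕ J` of a two-sorted `L⁺`-structure. -/
instance plusStructure (L : FirstOrder.Language.{u, v}) (G : Type*) [L.Structure G] (J : Type*)
    [SecondSort L G J] : (plus L).Structure (G ⊕ J) where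
  funMap := fun {_} F => match F with
    | PlusFunctions.base f =>
        extendSort Sum.inl (fun a : _ → G => Sum.inl (Structure.funMap f a))
    | PlusFunctions.dist =>
        extendSort Sum.inr (fun a : _ → J => Sum.inr (SecondSort.dist L G (a 0) (a 1)))
    | PlusFunctions.mu φ =>
        extendSort Sum.inl (fun a : _ → G => Sum.inr (SecondSort.mu φ a))
  RelMap := fun {_} R => match R with
    | PlusRelations.base R => fun x => ∃ a : _ → G, x = Sum.inl ∘ a ∧ Structure.RelMap R a
    | PlusRelations.home => fun x => ∃ g : G, x 0 = Sum.inl g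
    | PlusRelations.lt => fun x =>
        ∃ a : _ → J, x = Sum.inr ∘ a ∧ SecondSort.lt L G (a 0) (a 1)

/-- The normalized counting measure of a subset of a finite type, as an element of `[0,1]`. -/
def countingMeasure {X : Type*} [Finite X] (S : Set X) : unitInterval :=
  ⟨(S.ncard : ℝ) / (Nat.card X : ℝ), by positivity,
    div_le_one_of_le₀ (by exact_mod_cast S.ncard_le_card) (by positivity)⟩

/-- The canonical `L⁺`-expansion of a finite `L`-structure `A`: the second sort is `[0,1]` with its
order and distance, and `μ_φ(b)` is the normalized counting measure of `φ(A^m; b)`. -/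
instance finiteSecondSort (L : FirstOrder.Language.{u, v}) (A : Type*) [L.Structure A] [Finite A] :
    SecondSort L A unitInterval where
  lt s t := s < t
  dist s t := ⟨|(s : ℝ) - t|, abs_nonneg _,
    abs_le.2 ⟨by linarith [s.2.1, t.2.2], by linarith [s.2.2, t.2.1]⟩⟩
  mu φ b := countingMeasure {a | φ.Realize (Sum.elim a b)}

/-! ### The pseudofinite counting measure -/

section Measure

variable {L : FirstOrder.Language.{u, v}} {ι : Type*} {U : Ultrafilter ι} {A : ι → Type*}
  [∀ i, L.Structure (A i)] [∀ i, Finite (A i)] {G : Type*} [L.Structure G] {J : Type*}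
  [SecondSort L G J]

/-- The image in an elementary extension of the ultraproduct of the standard number `s ∈ [0,1]`. -/
def standardPoint (e : ((U : Filter ι).Product fun i => A i ⊕ unitInterval) ↪ₑ[plus L] (G ⊕ J))
    (s : unitInterval) : G ⊕ J :=
  e ((fun _ => Sum.inr s : ∀ i, A i ⊕ unitInterval) :
    (U : Filter ι).Product fun i => A i ⊕ unitInterval)

/-- The standard part of `j`: the supremum of the `s ∈ [0,1]` with `s ≤ j`. -/
def standardPart (e : ((U : Filter ι).Product fun i => A i ⊕ unitInterval) ↪ₑ[plus L] (G ⊕ J))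
    (j : J) : ℝ :=
  sSup ((fun s : unitInterval => (s : ℝ)) ''
    {s | ¬ Structure.RelMap (L := plus L) (PlusRelations.lt : PlusRelations L 2)
      ![Sum.inr j, standardPoint e s]})

/-- The pseudofinite counting measure `μ(φ(x̄; b̄))`, the standard part of `μ_φ(b̄)`. -/
def measure (e : ((U : Filter ι).Product fun i => A i ⊕ unitInterval) ↪ₑ[plus L] (G ⊕ J))
    {m n : ℕ} (φ : L.Formula (Fin m ⊕ Fin n)) (b : Fin n → G) : ℝ :=
  standardPart e (SecondSort.mu φ b : J)

end Measure

/-! ### Formulas `φ(x)` with parameters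

A formula with parameters is an `L`-formula `φ(x; z̄)` together with a tuple `c` for `z̄`. In
`φ(x; z̄, y)` the last parameter variable is the distinguished variable `y`. -/

section Formulas

variable {L : FirstOrder.Language.{u, v}} {n : ℕ}

/-- The formula `φ^ℓ(x; z̄, y) = φ(y · x; z̄)`. -/
def formulaLeft [GroupLanguage L] (φ : L.Formula (Fin 1 ⊕ Fin n)) :
    L.Formula (Fin 1 ⊕ Fin (n + 1)) :=
  BoundedFormula.subst φ (Sum.elim
    (fun _ => (GroupLanguage.mulSym : L.Functions 2).apply₂ (Term.var (Sum.inr (Fin.last n))) (Term.var (Sum.inl 0)))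
    (fun i => Term.var (Sum.inr i.castSucc)))

/-- The formula `φ^r(x; z̄, y) = φ(x · y; z̄)`. -/
def formulaRight [GroupLanguage L] (φ : L.Formula (Fin 1 ⊕ Fin n)) :
    L.Formula (Fin 1 ⊕ Fin (n + 1)) :=
  BoundedFormula.subst φ (Sum.elim
    (fun _ => (GroupLanguage.mulSym : L.Functions 2).apply₂ (Term.var (Sum.inl 0)) (Term.var (Sum.inr (Fin.last n))))
    (fun i => Term.var (Sum.inr i.castSucc)))

/-- The symmetric difference `φ △ ψ`. -/
def symmDiffFormula {α : Type*} (φ ψ : L.Formula α) : L.Formula α :=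
  (φ ⊓ ∼ψ) ⊔ (ψ ⊓ ∼φ)

/-- The formula `φ(y · x; z̄) △ φ(x; z̄)`. -/
def translateDiff [GroupLanguage L] (φ : L.Formula (Fin 1 ⊕ Fin n)) :
    L.Formula (Fin 1 ⊕ Fin (n + 1)) :=
  symmDiffFormula (formulaLeft φ) (φ.relabel (Sum.map id Fin.castSucc))

/-- The binary relation on `G` defined by `δ(x; c, y)`. -/
def binaryRel {G : Type*} [L.Structure G] (δ : L.Formula (Fin 1 ⊕ Fin (n + 1))) (c : Fin n → G) :
    G → G → Prop :=
  fun x y => δ.Realize (Sum.elim (fun _ => x) (Fin.snoc (α := fun _ => G) c y))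

end Formulas

/-- `R(x; y)` is `k`-NIP. -/
def IsNIPWith {α β : Type*} (R : α → β → Prop) (k : ℕ) : Prop :=
  ¬ ∃ (a : Fin k → α) (b : Set (Fin k) → β), ∀ i X, R (a i) (b X) ↔ i ∈ X

/-- `R(x; y)` is NIP. -/
def IsNIP {α β : Type*} (R : α → β → Prop) : Prop :=
  ∃ k, 1 ≤ k ∧ IsNIPWith R k

/-- `X` is defined by a finite Boolean combination of instances `R(x; b)` with `b ∈ B`. -/
def DefinableBy {α β : Type*} (R : α → β → Prop) (B : Set β) (X : Set α) : Prop :=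
  X ∈ BooleanSubalgebra.closure {S : Set α | ∃ b ∈ B, S = {x | R x b}}

/-- `X` is an intersection of sets that are defined by Boolean combinations of instances of `R`
with parameters in `B`. (There are at most `|B| + ℵ₀` such sets, so the size of the intersection is
controlled by that of `B`.) -/
def TypeDefinableBy {α β : Type*} (R : α → β → Prop) (B : Set β) (X : Set α) : Prop :=
  ∃ S : Set (Set α), (∀ Y ∈ S, DefinableBy R B Y) ∧ X = ⋂₀ S

/-- Finitely many left translates of `X` cover `G`. -/
def LeftGeneric {G : Type*} [Group G] (X : Set G) : Prop :=
  ∃ n : ℕ, 1 ≤ n ∧ ∃ g : Fin n → G, ⋃ i, g i • X = Set.univ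

/-- `Stab^ε_μ(φ) = {g : μ(φ(g⁻¹ x) △ φ(x)) ≤ ε}`, for the formula `φ(x; c)`. -/
def stab {L : FirstOrder.Language.{u, v}} [GroupLanguage L] {ι : Type*} {U : Ultrafilter ι}
    {A : ι → Type*} [∀ i, L.Structure (A i)] [∀ i, Finite (A i)]
    {G : Type*} [L.Structure G] [Group G] {J : Type*} [SecondSort L G J]
    (e : ((U : Filter ι).Product fun i => A i ⊕ unitInterval) ↪ₑ[plus L] (G ⊕ J))
    {n : ℕ} (φ : L.Formula (Fin 1 ⊕ Fin n)) (c : Fin n → G) (ε : ℝ) : Set G :=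
  {g | measure e (translateDiff φ) (Fin.snoc (α := fun _ => G) c g⁻¹) ≤ ε}

end PseudofiniteGroup

end

noncomputable section

namespace PseudofiniteGroup

/-! Let S be the set defined by φ and ν(g) = μ(φ(gx) △ φ(x)). Two facts about ν carry the theorem.
It is subadditive, ν(pq⁻¹) ≤ ν(p) + ν(q) (`measure_translateDiff_mul_inv_le`), and for each η > 0
there is a finite F ⊆ G such that ν(gh⁻¹) ≤ η whenever gx ∈ S ↔ hx ∈ S for all x ∈ F
(`exists_finset_measure_translateDiff_le`). As F admits only finitely many traces, the sets {ν ≤ ε}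
with ε > 0 are generic; as gx ∈ S is an instance of φ^r at g, sublevel sets are countable
intersections of φ^r-definable sets; and the zero set of ν is a subgroup whose cosets are coded by
sequences of natural numbers.

Both facts are proved in the finite groups and transferred to G by Łoś's theorem and elementarity.
Subadditivity is a count. For F, `exists_separating_tuple` gives a size N depending only on k and η,
so that its existence is a single L⁺-formula. The argument is Vapnik–Chervonenkis double sampling:
if no N-tuple separated, a random pair of tuples would be bad with probability at least η/2, whereas
random swaps between the two tuples make any given pair bad with probability at most K²/2^s, with K
polynomial in N by Sauer–Shelah and s ≤ ηN/2 chosen large. -/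

/-! ### Finite `ε`-nets for symmetric differences in families of bounded VC-dimension -/

section Net

open Finset

/-- Sauer–Shelah: a relation that is `k`-NIP cuts out polynomially many traces on a finite
tuple. -/
theorem card_traces_le {α β κ : Type*} [Fintype κ] [DecidableEq κ] {R : α → β → Prop} {k : ℕ}
    (hR : IsNIPWith R k) (z : κ → α) (𝒜 : Finset (Finset κ))
    (h𝒜 : ∀ T ∈ 𝒜, ∃ b, ∀ i, i ∈ T ↔ R (z i) b) :
    𝒜.card ≤ (k + 1) * (Fintype.card κ + 1) ^ k := by
  have hdim : 𝒜.vcDim ≤ k := by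
    refine Finset.sup_le fun s hs => ?_
    rw [mem_shatterer] at hs
    -- A shattered set with more than `k` elements contains a shattered `k`-subset, whose image
    -- under `z` violates `k`-NIP.
    by_contra! hk
    obtain ⟨t, hts, htk⟩ := exists_subset_card_eq hk.le
    have ht : 𝒜.Shatters t := hs.mono_right hts
    let f : Fin k → κ := fun i => (t.equivFinOfCardEq htk).symm i
    have hfinj : Function.Injective f :=
      Subtype.val_injective.comp (t.equivFinOfCardEq htk).symm.injective
    have hft : ∀ i, f i ∈ t := fun i => ((t.equivFinOfCardEq htk).symm i).2
    have key : ∀ X : Set (Fin k), ∃ b, ∀ i, R (z (f i)) b ↔ i ∈ X := by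
      classical
      intro X
      obtain ⟨u, hu, hut⟩ := ht (t := t.filter fun a => ∃ i ∈ X, f i = a) (filter_subset _ _)
      obtain ⟨b, hb⟩ := h𝒜 u hu
      refine ⟨b, fun i => ?_⟩
      rw [← hb]
      have := Finset.ext_iff.1 hut (f i)
      simp only [mem_inter, mem_filter, hft, true_and] at this
      rw [this]
      exact ⟨fun ⟨j, hj, hji⟩ => hfinj hji ▸ hj, fun hi => ⟨i, hi, rfl⟩⟩
    choose b hb using key
    exact hR ⟨z ∘ f, b, fun i X => hb X i⟩
  calc 𝒜.card ≤ 𝒜.shatterer.card := card_le_card_shatterer _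
    _ ≤ ∑ i ∈ Iic 𝒜.vcDim, (Fintype.card κ).choose i := card_shatterer_le_sum_vcDim
    _ ≤ ∑ i ∈ Iic k, (Fintype.card κ).choose i :=
        sum_le_sum_of_subset (Iic_subset_Iic.2 hdim)
    -- The `+ 1` keeps the base positive, so that the power is monotone in the exponent even for
    -- empty `κ`.
    _ ≤ ∑ i ∈ Iic k, (Fintype.card κ + 1) ^ k := by
        refine sum_le_sum fun i hi => ?_
        calc (Fintype.card κ).choose i ≤ (Fintype.card κ) ^ i := Nat.choose_le_pow _ _
          _ ≤ (Fintype.card κ + 1) ^ i := Nat.pow_le_pow_left (Nat.le_succ _) _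
          _ ≤ (Fintype.card κ + 1) ^ k := Nat.pow_le_pow_right (Nat.succ_pos _) (mem_Iic.1 hi)
    _ = _ := by simp

/-- A set of density at least `η` is hit by a proportion at least `η / 2` of all `N`-tuples in at
least `η N / 2` coordinates. -/
theorem le_card_hitting_tuples {A : Type*} [Fintype A] [DecidableEq A] (D : Finset A)
    {η : ℝ} {N s : ℕ} (hN : 0 < N) (hD : η * Fintype.card A ≤ D.card) (hs : (s : ℝ) ≤ η * N / 2) :
    η / 2 * (Fintype.card A : ℝ) ^ N ≤
      Finset.card {y : Fin N → A | s ≤ Finset.card {j | y j ∈ D}} := by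
  have hcoord : ∀ j : Fin N, Finset.card {y : Fin N → A | y j ∈ D} =
      D.card * Fintype.card A ^ (N - 1) := by
    intro j
    have : ({y : Fin N → A | y j ∈ D} : Finset _) =
        Fintype.piFinset (Function.update (fun _ => univ) j D) := by
      ext y
      simp only [mem_filter_univ, Fintype.mem_piFinset]
      constructor
      · intro h i
        by_cases hi : i = j
        · subst hi; simpa using h
        · simp [hi]
      · intro h
        simpa using h j
    rw [this, Fintype.card_piFinset, ← mul_prod_erase _ _ (mem_univ j)]
    congr 1
    · simp
    · rw [prod_congr rfl (g := fun _ => Fintype.card A)]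
      · simp
      · intro i hi
        simp [(mem_erase.1 hi).1, Finset.card_univ]
  have hsum : ∑ y : Fin N → A, Finset.card {j | y j ∈ D} =
      N * (D.card * Fintype.card A ^ (N - 1)) := by
    simp_rw [card_filter]
    rw [sum_comm]
    simp_rw [← card_filter, hcoord]
    simp
  set P := Finset.card {y : Fin N → A | s ≤ Finset.card {j | y j ∈ D}} with hP
  -- Reverse Markov inequality: a tuple hits `D` at most `N` times, and fewer than `s` times if it
  -- is not counted in `P`.
  have hbound : ∑ y : Fin N → A, Finset.card {j | y j ∈ D} ≤ N * P + s * Fintype.card A ^ N := by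
    calc ∑ y : Fin N → A, Finset.card {j | y j ∈ D}
        ≤ ∑ y : Fin N → A, (N * (if s ≤ Finset.card {j | y j ∈ D} then 1 else 0) + s) := by
          refine sum_le_sum fun y _ => ?_
          split_ifs with h
          · have : Finset.card {j | y j ∈ D} ≤ N := (card_filter_le _ _).trans (by simp)
            omega
          · omega
      _ = _ := by
          rw [sum_add_distrib, ← mul_sum, ← card_filter, hP]
          simp [mul_comm]
  rw [hsum] at hbound
  have hpow : (Fintype.card A : ℝ) ^ N = Fintype.card A * (Fintype.card A : ℝ) ^ (N - 1) := by
    rw [← pow_succ', Nat.sub_add_cancel hN]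
  have h1 : (N : ℝ) * (D.card * (Fintype.card A : ℝ) ^ (N - 1)) ≤
      N * P + s * (Fintype.card A : ℝ) ^ N := by exact_mod_cast hbound
  have hN' : (0 : ℝ) < N := by exact_mod_cast hN
  have h2 : η * (Fintype.card A : ℝ) ^ N ≤ D.card * (Fintype.card A : ℝ) ^ (N - 1) := by
    rw [hpow, ← mul_assoc]
    gcongr
  have h3 : (s : ℝ) * (Fintype.card A : ℝ) ^ N ≤ η * N / 2 * (Fintype.card A : ℝ) ^ N := by
    gcongr
  have h4 : (N : ℝ) * (η * (Fintype.card A : ℝ) ^ N) ≤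
      N * (D.card * (Fintype.card A : ℝ) ^ (N - 1)) := by gcongr
  refine le_of_mul_le_mul_left ?_ hN'
  linarith

/-- The number of ways to swap the rows of a `2 × N` table so that a fixed set of cells avoids the
first row, while it has at least `s` cells in the second. -/
theorem card_swaps_mul_le {N : ℕ} (E : Finset (Fin N × Bool)) (s : ℕ) :
    Finset.card {σ : Fin N → Bool | (∀ j, (j, σ j) ∉ E) ∧ s ≤ Finset.card {j | (j, !σ j) ∈ E}} *
      2 ^ s ≤ 2 ^ N := by
  set W : Finset (Fin N → Bool) :=
    {σ | (∀ j, (j, σ j) ∉ E) ∧ s ≤ Finset.card {j | (j, !σ j) ∈ E}} with hW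
  rcases W.eq_empty_or_nonempty with h0 | ⟨σ₀, hσ₀⟩
  · simp [h0]
  set I : Finset (Fin N) := {j | ∃ b, (j, b) ∈ E} with hI
  have hsI : s ≤ I.card := by
    rw [hW, mem_filter_univ] at hσ₀
    refine hσ₀.2.trans (card_le_card fun j hj => ?_)
    rw [mem_filter_univ] at hj
    rw [hI, mem_filter_univ]
    exact ⟨_, hj⟩
  -- At an index in `I` one of the two cells lies in `E`, so avoiding `E` forces the value of `σ`;
  -- hence `σ` is determined by its restriction to the complement of `I`.
  have hcard : W.card ≤ Fintype.card ({j // j ∈ Iᶜ} → Bool) := by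
    refine card_le_card_of_injOn (fun σ j => σ j) (fun _ _ => mem_univ _) ?_
    intro σ hσ τ hτ hστ
    simp only [hW, coe_filter, mem_univ, true_and, Set.mem_ofPred_eq] at hσ hτ
    funext j
    by_cases hj : j ∈ I
    · obtain ⟨b, hb⟩ := (mem_filter_univ j).1 hj
      have h1 : σ j ≠ b := fun h => hσ.1 j (h ▸ hb)
      have h2 : τ j ≠ b := fun h => hτ.1 j (h ▸ hb)
      cases b <;> simp_all
    · exact congrFun hστ ⟨j, mem_compl.2 hj⟩
  have hIN : I.card ≤ N := (card_le_univ I).trans (by simp)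
  rw [Fintype.card_fun, Fintype.card_bool, Fintype.card_coe, card_compl, Fintype.card_fin] at hcard
  calc W.card * 2 ^ s ≤ 2 ^ (N - I.card) * 2 ^ I.card :=
        Nat.mul_le_mul hcard (Nat.pow_le_pow_right (by norm_num) hsI)
    _ = 2 ^ N := by rw [← pow_add, Nat.sub_add_cancel hIN]

/-- In a finite set with a `k`-NIP family of subsets, some `N`-tuple separates any two members of
the family whose symmetric difference has density more than `η`, provided that `N` is large. -/
theorem exists_separating_tuple_of_bound {A β : Type*} [Fintype A] [Nonempty A]
    {R : A → β → Prop} {k : ℕ} (hR : IsNIPWith R k) {η : ℝ} {N s : ℕ} (hN : 0 < N)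
    (hs : (s : ℝ) ≤ η * N / 2)
    (hlarge : 2 * (((k + 1) * (2 * N + 1) ^ k : ℕ) : ℝ) ^ 2 < η * 2 ^ s) :
    ∃ x : Fin N → A, ∀ g h, (∀ j, R (x j) g ↔ R (x j) h) →
      ((({a | R a g ∧ ¬ R a h ∨ R a h ∧ ¬ R a g} : Set A).ncard : ℝ)) ≤ η * Fintype.card A := by
  classical
  by_contra! hbad
  choose g h hagree hbig using hbad
  let D : β → β → Finset A := fun g h => {a | R a g ∧ ¬ R a h ∨ R a h ∧ ¬ R a g}
  have hbig' : ∀ x, η * Fintype.card A ≤ (D (g x) (h x)).card := fun x => by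
    have := (hbig x).le
    rwa [Set.ncard_eq_toFinset_card', Set.toFinset_ofPred] at this
  -- A pair of tuples is bad if some symmetric difference misses the first tuple but hits the second
  -- at least `s` times.
  let Bad : (Fin N → A) × (Fin N → A) → Prop := fun p =>
    ∃ g h, (∀ j, p.1 j ∉ D g h) ∧ s ≤ Finset.card {j | p.2 j ∈ D g h}
  let W : Finset ((Fin N → A) × (Fin N → A)) := {p | Bad p}
  -- For every `x`, the pair `g x`, `h x` chosen for it makes `(x, y)` bad for a proportion at least
  -- `η / 2` of all `y`.
  have hlower : η / 2 * (Fintype.card A : ℝ) ^ N * (Fintype.card A : ℝ) ^ N ≤ W.card := by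
    have h1 : W.card = ∑ x : Fin N → A, Finset.card {y : Fin N → A | Bad (x, y)} := by
      simp only [W, card_filter, Fintype.sum_prod_type]
    have h2 : ∀ x : Fin N → A, η / 2 * (Fintype.card A : ℝ) ^ N ≤
        Finset.card {y : Fin N → A | Bad (x, y)} := by
      intro x
      refine (le_card_hitting_tuples (D (g x) (h x)) hN (hbig' x) hs).trans ?_
      refine Nat.cast_le.2 (card_le_card fun y hy => ?_)
      rw [mem_filter_univ] at hy ⊢
      refine ⟨g x, h x, fun j => ?_, hy⟩
      simp [D, hagree x j]
    rw [h1, Nat.cast_sum]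
    calc _ = ∑ _x : Fin N → A, η / 2 * (Fintype.card A : ℝ) ^ N := by
            simp [mul_comm]
      _ ≤ _ := sum_le_sum fun x _ => h2 x
  let cell : (Fin N → A) × (Fin N → A) → Fin N × Bool → A :=
    fun p c => if c.2 then p.2 c.1 else p.1 c.1
  let swap : (Fin N → Bool) → (Fin N → A) × (Fin N → A) → (Fin N → A) × (Fin N → A) :=
    fun σ p => (fun j => cell p (j, σ j), fun j => cell p (j, !σ j))
  have hswap : ∀ σ, Function.Involutive (swap σ) := by
    intro σ p
    refine Prod.ext (funext fun j => ?_) (funext fun j => ?_) <;>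
      cases hσ : σ j <;> simp [swap, cell, hσ]
  set K : ℕ := (k + 1) * (2 * N + 1) ^ k with hK
  -- For fixed `p`, only the traces of `D g h` on the `2N` cells matter. They are symmetric
  -- differences of two of at most `K` traces, and each serves at most `2 ^ (N - s)` swaps.
  have hfiber : ∀ p, Finset.card {σ | Bad (swap σ p)} * 2 ^ s ≤ K ^ 2 * 2 ^ N := by
    intro p
    let 𝒯 : Finset (Finset (Fin N × Bool)) := {T | ∃ b, ∀ i, i ∈ T ↔ R (cell p i) b}
    have h𝒯 : 𝒯.card ≤ K := by
      have := card_traces_le hR (cell p) 𝒯 (fun T hT => (mem_filter_univ T).1 hT)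
      rwa [Fintype.card_prod, Fintype.card_fin, Fintype.card_bool, mul_comm N 2] at this
    let F : Finset (Fin N × Bool) × Finset (Fin N × Bool) → Finset (Fin N → Bool) := fun T =>
      {σ | (∀ j, (j, σ j) ∉ symmDiff T.1 T.2) ∧ s ≤ Finset.card {j | (j, !σ j) ∈ symmDiff T.1 T.2}}
    have hsub : ({σ | Bad (swap σ p)} : Finset _) ⊆ (𝒯 ×ˢ 𝒯).biUnion F := by
      intro σ hσ
      obtain ⟨g, h, h1, h2⟩ := (mem_filter_univ σ).1 hσ
      let T : β → Finset (Fin N × Bool) := fun b => {i | R (cell p i) b}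
      have hT : ∀ b, T b ∈ 𝒯 := fun b => by
        rw [mem_filter_univ]; exact ⟨b, fun i => by simp [T]⟩
      have hmem : ∀ i, i ∈ symmDiff (T g) (T h) ↔ cell p i ∈ D g h := fun i => by
        simp only [T, D, mem_symmDiff, mem_filter_univ]
      refine mem_biUnion.2 ⟨(T g, T h), mem_product.2 ⟨hT g, hT h⟩, ?_⟩
      rw [mem_filter_univ]
      simp only [hmem]
      exact ⟨h1, h2⟩
    calc Finset.card {σ | Bad (swap σ p)} * 2 ^ s ≤ (∑ T ∈ 𝒯 ×ˢ 𝒯, (F T).card) * 2 ^ s :=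
          Nat.mul_le_mul_right _ ((card_le_card hsub).trans card_biUnion_le)
      _ = ∑ T ∈ 𝒯 ×ˢ 𝒯, (F T).card * 2 ^ s := sum_mul _ _ _
      _ ≤ ∑ T ∈ 𝒯 ×ˢ 𝒯, 2 ^ N := sum_le_sum fun T _ => card_swaps_mul_le _ _
      _ = 𝒯.card ^ 2 * 2 ^ N := by rw [sum_const, card_product, smul_eq_mul, sq]
      _ ≤ K ^ 2 * 2 ^ N := by gcongr
  -- Each swap permutes the pairs of tuples, so averaging over swaps leaves the number of bad pairs
  -- unchanged.
  have hcount : 2 ^ N * W.card = ∑ p, Finset.card {σ | Bad (swap σ p)} := by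
    have h1 : ∀ σ : Fin N → Bool, W.card = Finset.card {p | Bad (swap σ p)} := fun σ =>
      (card_equiv (hswap σ).toPerm fun p => by simp [W]).symm
    calc 2 ^ N * W.card = ∑ _σ : Fin N → Bool, W.card := by simp
      _ = ∑ σ : Fin N → Bool, Finset.card {p | Bad (swap σ p)} := sum_congr rfl fun σ _ => h1 σ
      _ = _ := by
        simp_rw [card_filter]
        exact sum_comm
  have hupper : 2 ^ N * W.card * 2 ^ s ≤ Fintype.card A ^ N * Fintype.card A ^ N * (K ^ 2 * 2 ^ N) := by
    rw [hcount, sum_mul]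
    calc _ ≤ ∑ _p : (Fin N → A) × (Fin N → A), K ^ 2 * 2 ^ N := sum_le_sum fun p _ => hfiber p
      _ = _ := by simp
  have hupper' : (W.card : ℝ) * 2 ^ s ≤
      (Fintype.card A : ℝ) ^ N * (Fintype.card A : ℝ) ^ N * (K : ℝ) ^ 2 := by
    have : (2 : ℝ) ^ N * W.card * 2 ^ s ≤
        (Fintype.card A : ℝ) ^ N * (Fintype.card A : ℝ) ^ N * ((K : ℝ) ^ 2 * 2 ^ N) := by
      exact_mod_cast hupper
    refine le_of_mul_le_mul_left (a := (2 : ℝ) ^ N) ?_ (by positivity)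
    linarith
  have hA : (0 : ℝ) < (Fintype.card A : ℝ) ^ N * (Fintype.card A : ℝ) ^ N := by
    have : 0 < Fintype.card A := Fintype.card_pos
    positivity
  have h1 := mul_le_mul_of_nonneg_right hlower (show (0 : ℝ) ≤ 2 ^ s by positivity)
  have h2 := mul_lt_mul_of_pos_right hlarge hA
  linarith

/-- Nets of size depending only on `k` and `η`. -/
theorem exists_separating_tuple (k : ℕ) {η : ℝ} (hη : 0 < η) :
    ∃ N : ℕ, ∀ (A β : Type*) [Fintype A] [Nonempty A] (R : A → β → Prop), IsNIPWith R k →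
      ∃ x : Fin N → A, ∀ g h, (∀ j, R (x j) g ↔ R (x j) h) →
        ((({a | R a g ∧ ¬ R a h ∨ R a h ∧ ¬ R a g} : Set A).ncard : ℝ)) ≤ η * Fintype.card A := by
  -- With `N = s * t` this choice gives `s ≤ η * N / 2` for every `s`; then `s` is taken so large
  -- that `2 ^ s` beats the polynomial in `s` of degree `2 * k`.
  obtain ⟨t, ht⟩ := exists_nat_ge (2 / η)
  have ht' : 2 ≤ η * t := by rwa [div_le_iff₀' hη] at ht
  have ht0 : 0 < t := by
    rcases Nat.eq_zero_or_pos t with rfl | h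
    · norm_num at ht'
    · exact h
  have hlim := (tendsto_pow_const_div_const_pow_of_one_lt (2 * k) (one_lt_two (α := ℝ))).const_mul
    (2 * ((k : ℝ) + 1) ^ 2 * (2 * t + 1) ^ (2 * k))
  rw [mul_zero] at hlim
  obtain ⟨s, hs, hs0⟩ := ((hlim.eventually (gt_mem_nhds hη)).and
    (Filter.eventually_gt_atTop 0)).exists
  refine ⟨s * t, fun A β _ _ R hR => exists_separating_tuple_of_bound hR (s := s)
    (Nat.mul_pos hs0 ht0) ?_ ?_⟩
  · push_cast
    have : (s : ℝ) * 2 ≤ s * (η * t) := by gcongr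
    linarith
  · rw [← mul_div_assoc, div_lt_iff₀ (by positivity)] at hs
    refine lt_of_le_of_lt ?_ hs
    have hs1 : (1 : ℝ) ≤ s := by exact_mod_cast hs0
    have hle : (2 * ((s : ℝ) * t) + 1) ≤ (2 * t + 1) * s := by nlinarith
    push_cast
    calc 2 * (((k : ℝ) + 1) * (2 * (s * t) + 1) ^ k) ^ 2
        ≤ 2 * (((k : ℝ) + 1) * ((2 * t + 1) * s) ^ k) ^ 2 := by gcongr
      _ = _ := by rw [mul_pow _ (s : ℝ)]; ring

end Net

/-! ### Stabilizers of a subadditive function with finite separating sets -/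

section Abstract

/-- A set that is a union of classes of "same trace on the finite set `F`" is a finite Boolean
combination of instances of `R` over `F`. -/
theorem definableBy_of_saturated {α β : Type*} {R : α → β → Prop} {B : Set β} (F : Finset β)
    (hF : ∀ b ∈ F, b ∈ B) (Y : Set α)
    (hY : ∀ g h, (∀ b ∈ F, R g b ↔ R h b) → g ∈ Y → h ∈ Y) : DefinableBy R B Y := by
  classical
  induction F using Finset.induction_on generalizing Y with
  | empty =>
    rcases Y.eq_empty_or_nonempty with rfl | ⟨g, hg⟩
    · exact BooleanSubalgebra.bot_mem
    · have : Y = ⊤ := Set.eq_univ_of_forall fun h => hY g h (by simp) hg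
      rw [this]
      exact BooleanSubalgebra.top_mem
  | insert b F _ ih =>
    have hF' : ∀ b ∈ F, b ∈ B := fun c hc => hF c (Finset.mem_insert_of_mem hc)
    have hb : {x | R x b} ∈ BooleanSubalgebra.closure {S : Set α | ∃ b ∈ B, S = {x | R x b}} :=
      BooleanSubalgebra.subset_closure ⟨b, hF b (Finset.mem_insert_self _ _), rfl⟩
    -- `Z P` is the saturation, for traces on the smaller `F`, of the part of `Y` satisfying `P`;
    -- `Y` is then split according to `R · b`.
    let Z : (α → Prop) → Set α := fun P => {g | ∃ h ∈ Y, P h ∧ ∀ c ∈ F, R g c ↔ R h c}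
    have hZ : ∀ P, DefinableBy R B (Z P) := fun P => by
      refine ih hF' _ ?_
      rintro g g' hgg' ⟨h, hh, hP, htr⟩
      exact ⟨h, hh, hP, fun c hc => (hgg' c hc).symm.trans (htr c hc)⟩
    have hEq : Y = (Z (fun h => R h b) ⊓ {x | R x b}) ⊔ (Z (fun h => ¬ R h b) ⊓ {x | R x b}ᶜ) := by
      ext g
      constructor
      · intro hg
        by_cases hgb : R g b
        · exact Or.inl ⟨⟨g, hg, hgb, fun _ _ => Iff.rfl⟩, hgb⟩
        · exact Or.inr ⟨⟨g, hg, hgb, fun _ _ => Iff.rfl⟩, hgb⟩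
      · rintro (⟨⟨h, hh, hP, htr⟩, hgb⟩ | ⟨⟨h, hh, hP, htr⟩, hgb⟩)
        · refine hY h g (fun c hc => ?_) hh
          rcases Finset.mem_insert.1 hc with rfl | hc
          · exact ⟨fun _ => hgb, fun _ => hP⟩
          · exact (htr c hc).symm
        · refine hY h g (fun c hc => ?_) hh
          rcases Finset.mem_insert.1 hc with rfl | hc
          · exact ⟨fun h => absurd h hP, fun h => absurd h hgb⟩
          · exact (htr c hc).symm
    rw [hEq]
    exact BooleanSubalgebra.sup_mem (BooleanSubalgebra.inf_mem (hZ _) hb)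
      (BooleanSubalgebra.inf_mem (hZ _) (BooleanSubalgebra.compl_mem hb))

/-! ### Sublevel sets of a subadditive function with finite nets -/

variable {G : Type*} [Group G] {S : Set G} {ν : G → ℝ}

theorem map_one_eq_zero_of_separating (h0 : ∀ g, 0 ≤ ν g)
    (hnet : ∀ η : ℝ, 0 < η → ∃ F : Finset G, ∀ g h, (∀ x ∈ F, g * x ∈ S ↔ h * x ∈ S) →
      ν (g * h⁻¹) ≤ η) : ν 1 = 0 := by
  refine le_antisymm (le_of_forall_pos_le_add fun η hη => ?_) (h0 1)
  obtain ⟨F, hF⟩ := hnet η hη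
  simpa using hF 1 1 fun _ _ => Iff.rfl

theorem map_inv_eq_of_subadditive (h1 : ν 1 = 0) (hsub : ∀ p q, ν (p * q⁻¹) ≤ ν p + ν q) (g : G) :
    ν g⁻¹ = ν g := by
  have key : ∀ g, ν g⁻¹ ≤ ν g := fun g => by simpa [h1] using hsub 1 g
  exact le_antisymm (key g) (by simpa using key g⁻¹)

theorem map_mul_le_of_subadditive (h1 : ν 1 = 0) (hsub : ∀ p q, ν (p * q⁻¹) ≤ ν p + ν q)
    (g h : G) : ν (g * h) ≤ ν g + ν h := by
  simpa [map_inv_eq_of_subadditive h1 hsub h] using hsub g h⁻¹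

theorem leftGeneric_sublevel
    (hnet : ∀ η : ℝ, 0 < η → ∃ F : Finset G, ∀ g h, (∀ x ∈ F, g * x ∈ S ↔ h * x ∈ S) →
      ν (g * h⁻¹) ≤ η) {ε : ℝ} (hε : 0 < ε) : LeftGeneric {g | ν g ≤ ε} := by
  classical
  obtain ⟨F, hF⟩ := hnet ε hε
  -- Traces of inverses are used because the net bounds `ν (g * h⁻¹)`, while left translates require
  -- a bound on `ν (r⁻¹ * g)`.
  let tr : G → (F → Prop) := fun g x => g⁻¹ * x ∈ S
  let T := Set.range tr
  have : Finite T := inferInstance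
  have : Nonempty T := ⟨⟨tr 1, 1, rfl⟩⟩
  choose r hr using fun t : T => t.2
  let E := Finite.equivFin T
  refine ⟨Nat.card T, Nat.card_pos, fun i => r (E.symm i), Set.eq_univ_of_forall fun g => ?_⟩
  let t : T := ⟨tr g, Set.mem_range_self g⟩
  refine Set.mem_iUnion.2 ⟨E t, ?_⟩
  have h := hF (r t)⁻¹ g⁻¹ fun x hx => iff_of_eq (congrFun (hr t) ⟨x, hx⟩)
  have hE : E.symm (E t) = t := E.symm_apply_apply t
  rw [Set.mem_smul_set_iff_inv_smul_mem]
  beta_reduce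
  rw [hE]
  simpa using h

/-- Saturating the sublevel set for traces on a net for `1 / (m + 1)` gives a definable set on which
`ν` is at most `ε + 1 / (m + 1)`; the intersection over `m` is the sublevel set itself. -/
theorem typeDefinableBy_sublevel (h1 : ν 1 = 0) (hsub : ∀ p q, ν (p * q⁻¹) ≤ ν p + ν q)
    (hnet : ∀ η : ℝ, 0 < η → ∃ F : Finset G, ∀ g h, (∀ x ∈ F, g * x ∈ S ↔ h * x ∈ S) →
      ν (g * h⁻¹) ≤ η) (ε : ℝ) :
    ∃ B : Set G, B.Countable ∧ TypeDefinableBy (fun x y => x * y ∈ S) B {g | ν g ≤ ε} := by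
  choose F hF using fun m : ℕ => hnet (1 / ((m : ℝ) + 1)) (by positivity)
  let Y : ℕ → Set G := fun m => {g | ∃ g', ν g' ≤ ε ∧ ∀ x ∈ F m, g * x ∈ S ↔ g' * x ∈ S}
  refine ⟨⋃ m, (F m : Set G), Set.countable_iUnion fun m => (F m).countable_toSet,
    Set.range Y, ?_, ?_⟩
  · rintro _ ⟨m, rfl⟩
    refine definableBy_of_saturated (F m) (fun b hb => Set.mem_iUnion.2 ⟨m, hb⟩) _ ?_
    rintro g h hgh ⟨g', hg', htr⟩
    exact ⟨g', hg', fun x hx => (hgh x hx).symm.trans (htr x hx)⟩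
  · ext g
    simp only [Set.sInter_range, Set.mem_iInter]
    constructor
    · exact fun hg m => ⟨g, hg, fun _ _ => Iff.rfl⟩
    · intro hg
      have hle : ∀ m : ℕ, ν g ≤ 1 / ((m : ℝ) + 1) + ε := fun m => by
        obtain ⟨g', hg', htr⟩ := hg m
        have h2 := map_mul_le_of_subadditive h1 hsub (g * g'⁻¹) g'
        rw [inv_mul_cancel_right] at h2
        linarith [hF m g g' htr]
      have hlim := (tendsto_one_div_add_atTop_nhds_zero_nat (𝕜 := ℝ)).add_const ε
      rw [zero_add] at hlim
      exact ge_of_tendsto' hlim hle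

/-- The subgroup of zeros of `ν`. -/
def zeroSubgroup (h1 : ν 1 = 0) (hsub : ∀ p q, ν (p * q⁻¹) ≤ ν p + ν q) :
    Subgroup G where
  carrier := {g | ν g ≤ 0}
  one_mem' := h1.le
  mul_mem' {a b} ha hb :=
    (map_mul_le_of_subadditive h1 hsub a b).trans (add_nonpos ha hb)
  inv_mem' {a} ha := (map_inv_eq_of_subadditive h1 hsub a).trans_le ha

/-- A coset is coded by recording, for each `m`, a translate of `{ν ≤ 1 / (m + 1)}` containing its
representative. Equal codes give `ν (p⁻¹ * q) ≤ 2 / (m + 1)` for all `m`. -/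
theorem mk_quotient_le_continuum {H : Subgroup G} (hH : (H : Set G) = {g | ν g ≤ 0})
    (h1 : ν 1 = 0) (hsub : ∀ p q, ν (p * q⁻¹) ≤ ν p + ν q)
    (hgen : ∀ ε : ℝ, 0 < ε → LeftGeneric {g | ν g ≤ ε}) : #(G ⧸ H) ≤ 𝔠 := by
  choose n _ g hg using fun m : ℕ => hgen (1 / ((m : ℝ) + 1)) (by positivity)
  have hcover : ∀ (x : G) (m : ℕ), ∃ i : Fin (n m), ν ((g m i)⁻¹ * x) ≤ 1 / ((m : ℝ) + 1) := by
    intro x m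
    have hx : x ∈ ⋃ i, g m i • {g | ν g ≤ 1 / ((m : ℝ) + 1)} := by rw [hg]; trivial
    obtain ⟨i, hi⟩ := Set.mem_iUnion.1 hx
    exact ⟨i, by simpa [Set.mem_smul_set_iff_inv_smul_mem] using hi⟩
  choose code hcode using hcover
  have hinj : Function.Injective fun (q : G ⧸ H) (m : ℕ) => (code q.out m : ℕ) := by
    intro p q hpq
    rw [← p.out_eq', ← q.out_eq', QuotientGroup.eq, ← SetLike.mem_coe, hH]
    have hle : ∀ m : ℕ, ν (p.out⁻¹ * q.out) ≤ 1 / ((m : ℝ) + 1) + 1 / ((m : ℝ) + 1) := fun m => by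
      have hc : code p.out m = code q.out m := Fin.ext (congrFun hpq m)
      have hp := hcode p.out m
      have hq := hcode q.out m
      rw [← hc] at hq
      have h2 := map_mul_le_of_subadditive h1 hsub ((g m (code p.out m))⁻¹ * p.out)⁻¹
        ((g m (code p.out m))⁻¹ * q.out)
      rw [map_inv_eq_of_subadditive h1 hsub] at h2
      have h3 : ((g m (code p.out m))⁻¹ * p.out)⁻¹ * ((g m (code p.out m))⁻¹ * q.out) =
          p.out⁻¹ * q.out := by group
      rw [h3] at h2
      linarith
    have hlim := (tendsto_one_div_add_atTop_nhds_zero_nat (𝕜 := ℝ)).add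
      (tendsto_one_div_add_atTop_nhds_zero_nat (𝕜 := ℝ))
    rw [add_zero] at hlim
    exact ge_of_tendsto' hlim hle
  -- The codes are lifted so that both cardinals live in the same universe.
  have h := Cardinal.mk_le_of_injective (Function.Injective.comp
    (Equiv.ulift.{_, 0} (α := ℕ → ℕ)).symm.injective hinj)
  simpa using h

end Abstract

/-! ### Relativization of `L`-formulas to the home sort -/

section Relativization

variable {L : FirstOrder.Language.{u, v}}

theorem extendSort_comp {α M : Type*} {n : ℕ} {i : α → M} (hi : Function.Injective i)
    (f : (Fin n → α) → M) (a : Fin n → α) : extendSort i f (i ∘ a) = f a := by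
  have h : ∃ b : Fin n → α, i ∘ a = i ∘ b := ⟨a, rfl⟩
  rw [extendSort, dif_pos h]
  congr 1
  exact (hi.comp_left h.choose_spec).symm

/-- A function symbol of `L` as a symbol of `L⁺`. -/
def baseFun {n : ℕ} (f : L.Functions n) : (plus L).Functions n := PlusFunctions.base f

/-- The symbol `μ_θ` of `L⁺`. -/
def muFun {m n : ℕ} (θ : L.Formula (Fin m ⊕ Fin n)) : (plus L).Functions n := PlusFunctions.mu θ

/-- A relation symbol of `L` as a symbol of `L⁺`. -/
def baseRel {n : ℕ} (R : L.Relations n) : (plus L).Relations n := PlusRelations.base R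

variable (L) in
/-- The predicate of `L⁺` for the home sort. -/
def homeSym : (plus L).Relations 1 := PlusRelations.home (L := L)

variable (L) in
/-- The symbol `<` of `L⁺`. -/
def ltSym : (plus L).Relations 2 := PlusRelations.lt (L := L)

/-- An `L`-term as an `L⁺`-term. -/
def plusTerm {α : Type*} : L.Term α → (plus L).Term α
  | .var a => .var a
  | .func f ts => .func (baseFun f) fun i => plusTerm (ts i)

/-- The `L⁺`-formula expressing that a term belongs to the home sort. -/
def isHome {α : Type*} {n : ℕ} (t : (plus L).Term (α ⊕ Fin n)) : (plus L).BoundedFormula α n :=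
  Relations.boundedFormula₁ (homeSym L) t

/-- An `L`-formula as an `L⁺`-formula, with quantifiers relativized to the home sort. -/
def relativize {α : Type*} : ∀ {n : ℕ}, L.BoundedFormula α n → (plus L).BoundedFormula α n
  | _, .falsum => .falsum
  | _, .equal t₁ t₂ => .equal (plusTerm t₁) (plusTerm t₂)
  | _, .rel R ts => .rel (baseRel R) fun i => plusTerm (ts i)
  | _, .imp φ ψ => .imp (relativize φ) (relativize ψ)
  | _, .all φ => .all ((isHome (Term.var (Sum.inr (Fin.last _)))).imp (relativize φ))

variable {G : Type*} [L.Structure G] {J : Type*} [SecondSort L G J] {α β : Type*}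

theorem realize_plusTerm (t : L.Term α) (v : α → G) :
    (plusTerm t).realize (fun a => (Sum.inl (v a) : G ⊕ J)) = Sum.inl (t.realize v) := by
  induction t with
  | var a => rfl
  | func f ts ih =>
    simp only [plusTerm, Term.realize, ih]
    exact extendSort_comp Sum.inl_injective _ fun i => (ts i).realize v

theorem relMap_home (x : Fin 1 → G ⊕ J) :
    Structure.RelMap (homeSym L) x ↔
      ∃ g : G, x 0 = Sum.inl g := Iff.rfl

theorem relMap_base {n : ℕ} (R : L.Relations n) (a : Fin n → G) :
    Structure.RelMap (baseRel R)
      (fun i => (Sum.inl (a i) : G ⊕ J)) ↔ Structure.RelMap R a := by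
  constructor
  · rintro ⟨b, hab, hb⟩
    rwa [show a = b from funext fun i => Sum.inl_injective (congrFun hab i)]
  · exact fun h => ⟨a, rfl, h⟩

theorem funMap_muFun {m n : ℕ} (θ : L.Formula (Fin m ⊕ Fin n)) (b : Fin n → G) :
    Structure.funMap (muFun θ) (fun i => (Sum.inl (b i) : G ⊕ J)) =
      Sum.inr (SecondSort.mu θ b : J) :=
  extendSort_comp (Sum.inl_injective (α := G) (β := J))
    (fun a : _ → G => Sum.inr (SecondSort.mu θ a)) b

theorem realize_isHome {n : ℕ} (t : (plus L).Term (α ⊕ Fin n)) (v : α → G ⊕ J)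
    (xs : Fin n → G ⊕ J) :
    (isHome t).Realize v xs ↔ ∃ g : G, t.realize (Sum.elim v xs) = Sum.inl g := by
  rw [isHome, BoundedFormula.realize_rel₁, relMap_home]
  rfl

theorem elim_inl_comp {n : ℕ} (v : α → G) (xs : Fin n → G) :
    Sum.elim (fun a => (Sum.inl (v a) : G ⊕ J)) (fun i => Sum.inl (xs i)) =
      fun a => Sum.inl (Sum.elim v xs a) := by
  funext a
  cases a <;> rfl

theorem realize_relativize_bounded {n : ℕ} (φ : L.BoundedFormula α n) (v : α → G) (xs : Fin n → G) :
    (relativize φ).Realize (fun a => (Sum.inl (v a) : G ⊕ J)) (fun i => Sum.inl (xs i)) ↔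
      φ.Realize v xs := by
  induction φ with
  | falsum => exact Iff.rfl
  | equal t₁ t₂ =>
    simp only [relativize, BoundedFormula.Realize, elim_inl_comp, realize_plusTerm,
      Sum.inl_injective.eq_iff]
  | rel R ts =>
    simp only [relativize, BoundedFormula.Realize, elim_inl_comp, realize_plusTerm]
    exact relMap_base R _
  | imp φ ψ ih₁ ih₂ => simp only [relativize, BoundedFormula.Realize, ih₁, ih₂]
  | all φ ih =>
    simp only [relativize, BoundedFormula.realize_all, BoundedFormula.realize_imp, realize_isHome,
      Term.realize_var, Sum.elim_inr, Fin.snoc_last]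
    have hsnoc : ∀ g : G, Fin.snoc (α := fun _ => G ⊕ J) (fun i => Sum.inl (xs i)) (Sum.inl g) =
        fun i => Sum.inl (Fin.snoc (α := fun _ => G) xs g i) := fun g => by
      funext i
      refine Fin.lastCases ?_ (fun i => ?_) i <;> simp
    constructor
    · intro h g
      rw [← ih, ← hsnoc]
      exact h _ ⟨g, rfl⟩
    · rintro h _ ⟨g, rfl⟩
      rw [hsnoc, ih]
      exact h g

theorem realize_relativize (φ : L.Formula α) (v : α → G) :
    Formula.Realize (relativize φ) (fun a => (Sum.inl (v a) : G ⊕ J)) ↔ φ.Realize v := by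
  rw [Formula.Realize, Formula.Realize, ← realize_relativize_bounded (J := J) φ v default]
  exact iff_of_eq (congrArg _ (Subsingleton.elim _ _))

/-! ### Quantifiers over the home sort and comparisons of measures -/

/-- Universal quantification over a finite tuple from the home sort. -/
def homeAlls (β : Type*) [Finite β] (ψ : (plus L).Formula (α ⊕ β)) : (plus L).Formula α :=
  Formula.iAlls β (Formula.imp (Formula.iInf fun b : β => isHome (Term.var (Sum.inl (Sum.inr b)))) ψ)

/-- Existential quantification over a finite tuple from the home sort. -/
def homeExs (β : Type*) [Finite β] (ψ : (plus L).Formula (α ⊕ β)) : (plus L).Formula α :=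
  Formula.iExs β ((Formula.iInf fun b : β => isHome (Term.var (Sum.inl (Sum.inr b)))) ⊓ ψ)

theorem realize_iInf_isHome [Finite β] (v : α ⊕ β → G ⊕ J) :
    (Formula.iInf fun b : β => isHome (L := L) (α := α ⊕ β)
      (Term.var (Sum.inl (Sum.inr b)))).Realize v ↔
      ∃ a : β → G, ∀ b, v (Sum.inr b) = Sum.inl (a b) := by
  rw [Formula.realize_iInf]
  simp only [Formula.Realize, realize_isHome, Term.realize_var, Sum.elim_inl]
  exact ⟨fun h => ⟨fun b => (h b).choose, fun b => (h b).choose_spec⟩,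
    fun ⟨a, ha⟩ b => ⟨a b, ha b⟩⟩

theorem realize_homeAlls [Finite β] (ψ : (plus L).Formula (α ⊕ β)) (v : α → G ⊕ J) :
    (homeAlls β ψ).Realize v ↔ ∀ a : β → G, ψ.Realize (Sum.elim v fun b => Sum.inl (a b)) := by
  rw [homeAlls, Formula.realize_iAlls]
  simp only [Formula.realize_imp, realize_iInf_isHome, Sum.elim_inr]
  constructor
  · exact fun h a => h _ ⟨a, fun _ => rfl⟩
  · rintro h i ⟨a, ha⟩
    rw [show i = fun b => Sum.inl (a b) from funext ha]
    exact h a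

theorem realize_homeExs [Finite β] (ψ : (plus L).Formula (α ⊕ β)) (v : α → G ⊕ J) :
    (homeExs β ψ).Realize v ↔ ∃ a : β → G, ψ.Realize (Sum.elim v fun b => Sum.inl (a b)) := by
  rw [homeExs, Formula.realize_iExs]
  simp only [Formula.realize_inf, realize_iInf_isHome, Sum.elim_inr]
  constructor
  · rintro ⟨i, ⟨a, ha⟩, h⟩
    rw [show i = fun b => Sum.inl (a b) from funext ha] at h
    exact ⟨a, h⟩
  · exact fun ⟨a, h⟩ => ⟨_, ⟨a, fun _ => rfl⟩, h⟩

/-- The `L⁺`-formula `μ_θ(f) ≤ w`. -/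
def muLe {m n : ℕ} (θ : L.Formula (Fin m ⊕ Fin n)) (f : Fin n → α) (w : α) : (plus L).Formula α :=
  ∼ (Relations.formula₂ (ltSym L) (Term.var w)
    (Term.func (muFun θ) fun i => Term.var (f i)))

theorem realize_muLe {m n : ℕ} (θ : L.Formula (Fin m ⊕ Fin n)) (f : Fin n → α) (w : α)
    (v : α → G ⊕ J) (b : Fin n → G) (hb : ∀ i, v (f i) = Sum.inl (b i)) :
    (muLe θ f w).Realize v ↔
      ¬ Structure.RelMap (ltSym L) ![v w, Sum.inr (SecondSort.mu θ b : J)] := by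
  rw [muLe, Formula.realize_not, Formula.realize_rel₂]
  simp only [Term.realize_var, Term.realize_func, hb, funMap_muFun]

theorem relMap_lt_inr (s t : J) :
    Structure.RelMap (ltSym L) ![(Sum.inr s : G ⊕ J), Sum.inr t] ↔ SecondSort.lt L G s t := by
  constructor
  · rintro ⟨a, ha, h⟩
    have h0 : s = a 0 := Sum.inr_injective (congrFun ha 0)
    have h1 : t = a 1 := Sum.inr_injective (congrFun ha 1)
    rwa [h0, h1]
  · intro h
    refine ⟨![s, t], ?_, h⟩
    funext i
    fin_cases i <;> rfl

variable (L) in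
/-- The `L⁺`-formula `∀ x ∈ I, x < w₁ ∨ w₀ < x`. -/
def comparableFormula : (plus L).Formula (Fin 2) :=
  Formula.iAlls Unit (isHome (Term.var (Sum.inl (Sum.inr ()))) ⊔
    (Relations.formula₂ (ltSym L) (Term.var (Sum.inr ())) (Term.var (Sum.inl 1)) ⊔
      Relations.formula₂ (ltSym L) (Term.var (Sum.inl 0)) (Term.var (Sum.inr ()))))

theorem realize_comparableFormula (v : Fin 2 → G ⊕ J) :
    (comparableFormula L).Realize v ↔ ∀ k : J, Structure.RelMap (ltSym L) ![Sum.inr k, v 1] ∨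
      Structure.RelMap (ltSym L) ![v 0, Sum.inr k] := by
  rw [comparableFormula, Formula.realize_iAlls]
  simp only [Formula.realize_sup, Formula.realize_rel₂, Term.realize_var, Sum.elim_inl,
    Sum.elim_inr]
  simp only [Formula.Realize, realize_isHome, Term.realize_var, Sum.elim_inl, Sum.elim_inr]
  constructor
  · intro h k
    simpa using h fun _ => Sum.inr k
  · intro h i
    rcases hi : i () with g | k
    · exact Or.inl ⟨g, rfl⟩
    · exact Or.inr (h k)

variable (L) in
/-- The `L⁺`-formula `∀ x ∈ I, ¬ (x < w ∧ w < x)`. -/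
def asymmFormula : (plus L).Formula Unit :=
  Formula.iAlls Unit (isHome (Term.var (Sum.inl (Sum.inr ()))) ⊔
    ∼ (Relations.formula₂ (ltSym L) (Term.var (Sum.inr ())) (Term.var (Sum.inl ())) ⊓
      Relations.formula₂ (ltSym L) (Term.var (Sum.inl ())) (Term.var (Sum.inr ()))))

theorem realize_asymmFormula (v : Unit → G ⊕ J) :
    (asymmFormula L).Realize v ↔ ∀ k : J, ¬ (Structure.RelMap (ltSym L) ![Sum.inr k, v ()] ∧
      Structure.RelMap (ltSym L) ![v (), Sum.inr k]) := by
  rw [asymmFormula, Formula.realize_iAlls]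
  simp only [Formula.realize_sup, Formula.realize_not, Formula.realize_inf, Formula.realize_rel₂,
    Term.realize_var, Sum.elim_inl, Sum.elim_inr]
  simp only [Formula.Realize, realize_isHome, Term.realize_var, Sum.elim_inl, Sum.elim_inr]
  constructor
  · intro h k
    simpa using h fun _ => Sum.inr k
  · intro h i
    rcases hi : i () with g | k
    · exact Or.inl ⟨g, rfl⟩
    · exact Or.inr (h k)

end Relativization

/-! ### Standard parts -/

section Standard

variable {L : FirstOrder.Language.{u, v}} {ι : Type*} {U : Ultrafilter ι} {A : ι → Type*}
  [∀ i, L.Structure (A i)] [∀ i, Finite (A i)] {G : Type*} [L.Structure G] {J : Type*}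
  [SecondSort L G J]
  (e : ((U : Filter ι).Product fun i => A i ⊕ unitInterval) ↪ₑ[plus L] (G ⊕ J))

/-- Łoś's theorem for `L⁺`-formulas with standard parameters. -/
theorem realize_standardPoint {α : Type*} (ψ : (plus L).Formula α) (s : α → unitInterval)
    (h : ∀ i, ψ.Realize fun a => (Sum.inr (s a) : A i ⊕ unitInterval)) :
    ψ.Realize fun a => standardPoint e (s a) :=
  (e.map_formula ψ _).2 ((Ultraproduct.realize_formula_cast ψ
    fun a i => (Sum.inr (s a) : A i ⊕ unitInterval)).2 (Filter.Eventually.of_forall h))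

theorem relMap_lt_finite {A : Type*} [L.Structure A] [Finite A] (s t : unitInterval) :
    Structure.RelMap (ltSym L) ![(Sum.inr s : A ⊕ unitInterval), Sum.inr t] ↔ s < t :=
  relMap_lt_inr s t

/-- No order axioms are assumed on `J`; this fragment of linearity is transferred from [0,1].
Standard points are not shown to lie in `J`, so `<` is read on all of `G ⊕ J`. -/
theorem lt_standardPoint_or (j : J) {s t : unitInterval} (hst : s < t) :
    Structure.RelMap (ltSym L) ![Sum.inr j, standardPoint e t] ∨
      Structure.RelMap (ltSym L) ![standardPoint e s, Sum.inr j] := by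
  have h := realize_standardPoint e (comparableFormula L) ![s, t] fun i => by
    rw [realize_comparableFormula]
    intro k
    exact (lt_or_ge k t).imp (fun h => (relMap_lt_finite k t).2 h)
      fun h => (relMap_lt_finite s k).2 (hst.trans_le h)
  exact (realize_comparableFormula _).1 h j

theorem not_lt_standardPoint (j : J) {s : unitInterval}
    (hs : Structure.RelMap (ltSym L) ![Sum.inr j, standardPoint e s]) :
    ¬ Structure.RelMap (ltSym L) ![standardPoint e s, Sum.inr j] := by
  have h := realize_standardPoint e (asymmFormula L) (fun _ : Unit => s) fun i => by
    rw [realize_asymmFormula]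
    rintro k ⟨h1, h2⟩
    exact lt_asymm ((relMap_lt_finite k s).1 h1) ((relMap_lt_finite s k).1 h2)
  exact fun h2 => (realize_asymmFormula _).1 h j ⟨hs, h2⟩

theorem bddAbove_standardPart (j : J) : BddAbove ((fun s : unitInterval => (s : ℝ)) ''
    {s | ¬ Structure.RelMap (L := plus L) (PlusRelations.lt : PlusRelations L 2)
      ![Sum.inr j, standardPoint e s]}) :=
  ⟨1, by rintro _ ⟨s, -, rfl⟩; exact s.2.2⟩

theorem standardPart_nonneg (j : J) : 0 ≤ standardPart e j :=
  Real.sSup_nonneg (by rintro _ ⟨s, -, rfl⟩; exact s.2.1)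

theorem standardPart_le_one (j : J) : standardPart e j ≤ 1 :=
  Real.sSup_le (by rintro _ ⟨s, -, rfl⟩; exact s.2.2) zero_le_one

/-- With `not_lt_of_standardPart_lt` this translates between real inequalities and L⁺-formulas. The
other direction needs strictness, since `j` may lie infinitesimally above its standard part. -/
theorem standardPart_le (j : J) {s : unitInterval}
    (h : ¬ Structure.RelMap (ltSym L) ![standardPoint e s, Sum.inr j]) :
    standardPart e j ≤ s := by
  -- Nonnegativity of `s` covers the empty set, whose supremum is 0.
  refine Real.sSup_le ?_ s.2.1
  rintro _ ⟨t, ht, rfl⟩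
  by_contra! hst
  exact (lt_standardPoint_or e j (show s < t from hst)).elim ht h

theorem not_lt_of_standardPart_lt (j : J) {s : unitInterval} (h : standardPart e j < s) :
    ¬ Structure.RelMap (ltSym L) ![standardPoint e s, Sum.inr j] := by
  refine not_lt_standardPoint e j ?_
  by_contra hs
  exact absurd (le_csSup (bddAbove_standardPart e j) ⟨s, hs, rfl⟩) (not_le.2 h)

end Standard

/-! ### The formulas `φ^ℓ`, `φ^r` and `φ(y · x) △ φ(x)` -/

section Realize

variable {L : FirstOrder.Language.{u, v}} {n : ℕ} {G : Type*} [L.Structure G]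

/-- The subset of `G` defined by `φ(x; c)`. -/
def solutionSet (φ : L.Formula (Fin 1 ⊕ Fin n)) (c : Fin n → G) : Set G :=
  {g | φ.Realize (Sum.elim (fun _ => g) c)}

/-- The formula `φ(t; c)` for a term `t`. -/
def substTerm {α : Type*} (φ : L.Formula (Fin 1 ⊕ Fin n)) (t : L.Term α) (c : Fin n → α) :
    L.Formula α :=
  BoundedFormula.subst φ (Sum.elim (fun _ => t) fun i => Term.var (c i))

theorem realize_substTerm {α : Type*} (φ : L.Formula (Fin 1 ⊕ Fin n)) (t : L.Term α)
    (c : Fin n → α) (v : α → G) :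
    (substTerm φ t c).Realize v ↔ t.realize v ∈ solutionSet φ fun i => v (c i) := by
  rw [substTerm, Formula.Realize, BoundedFormula.realize_subst]
  refine iff_of_eq (congrArg (fun w => φ.Realize w) ?_)
  funext i
  rcases i with i | i <;> rfl

variable [GroupLanguage L] [Group G] [CompatibleGroup L G]

theorem realize_mulSym {α : Type*} (t₁ t₂ : L.Term α) (v : α → G) :
    ((GroupLanguage.mulSym : L.Functions 2).apply₂ t₁ t₂).realize v =
      t₁.realize v * t₂.realize v := by
  rw [Term.realize_functions_apply₂, CompatibleGroup.funMap_mul]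
  rfl

theorem realize_formulaLeft (φ : L.Formula (Fin 1 ⊕ Fin n)) (c : Fin n → G) (a : Fin 1 → G)
    (y : G) :
    (formulaLeft φ).Realize (Sum.elim a (Fin.snoc (α := fun _ => G) c y)) ↔
      y * a 0 ∈ solutionSet φ c := by
  refine (realize_substTerm φ _ (fun i => Sum.inr i.castSucc) _).trans ?_
  rw [realize_mulSym]
  simp

theorem realize_formulaRight (φ : L.Formula (Fin 1 ⊕ Fin n)) (c : Fin n → G) (a : Fin 1 → G)
    (y : G) :
    (formulaRight φ).Realize (Sum.elim a (Fin.snoc (α := fun _ => G) c y)) ↔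
      a 0 * y ∈ solutionSet φ c := by
  refine (realize_substTerm φ _ (fun i => Sum.inr i.castSucc) _).trans ?_
  rw [realize_mulSym]
  simp

/-- The set of `x` with `p x ∈ S` and `x ∉ S`, or `x ∈ S` and `p x ∉ S`. -/
def translateDiffSet {G : Type*} [Group G] (S : Set G) (p : G) : Set G :=
  {x | p * x ∈ S ∧ ¬ x ∈ S ∨ x ∈ S ∧ ¬ p * x ∈ S}

theorem realize_translateDiff (φ : L.Formula (Fin 1 ⊕ Fin n)) (c : Fin n → G) (a : Fin 1 → G)
    (y : G) :
    (translateDiff φ).Realize (Sum.elim a (Fin.snoc (α := fun _ => G) c y)) ↔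
      a 0 ∈ translateDiffSet (solutionSet φ c) y := by
  have h : (φ.relabel (Sum.map id Fin.castSucc)).Realize
      (Sum.elim a (Fin.snoc (α := fun _ => G) c y)) ↔ a 0 ∈ solutionSet φ c := by
    rw [Formula.realize_relabel]
    refine iff_of_eq (congrArg (fun w => φ.Realize w) ?_)
    funext i
    rcases i with i | i
    · rw [Subsingleton.elim i 0]; rfl
    · simp
  rw [translateDiff, symmDiffFormula, Formula.realize_sup, Formula.realize_inf,
    Formula.realize_inf, Formula.realize_not, Formula.realize_not, realize_formulaLeft, h]
  rfl

/-- For a finite structure, `μ_θ(c, p) ≤ r` with `θ = φ(y · x) △ φ(x)` is a bound on the number of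
elements of `p⁻¹ S △ S`. -/
theorem mu_translateDiff_le_iff {A : Type*} [L.Structure A] [Group A] [CompatibleGroup L A]
    [Finite A] (φ : L.Formula (Fin 1 ⊕ Fin n)) (c : Fin n → A) (p : A) (r : unitInterval) :
    (finiteSecondSort L A).mu (translateDiff φ) (Fin.snoc (α := fun _ => A) c p) ≤ r ↔
      ((translateDiffSet (solutionSet φ c) p).ncard : ℝ) ≤ r * Nat.card A := by
  -- The measure counts tuples `Fin 1 → A`, so numerator and denominator are both carried over to
  -- `A`.
  have hset : {a : Fin 1 → A | (translateDiff φ).Realize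
      (Sum.elim a (Fin.snoc (α := fun _ => A) c p))} =
      (Equiv.funUnique (Fin 1) A) ⁻¹' (translateDiffSet (solutionSet φ c) p) := by
    ext a
    exact realize_translateDiff φ c a p
  have hcard : {a : Fin 1 → A | (translateDiff φ).Realize
      (Sum.elim a (Fin.snoc (α := fun _ => A) c p))}.ncard =
      (translateDiffSet (solutionSet φ c) p).ncard := by
    rw [hset]
    exact Set.ncard_preimage_of_injective_subset_range (Equiv.injective _) (by simp)
  have hpos : (0 : ℝ) < Nat.card A := by exact_mod_cast Nat.card_pos
  rw [← div_le_iff₀ hpos, ← hcard, ← Nat.card_congr (Equiv.funUnique (Fin 1) A)]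
  rfl

end Realize

/-! ### Subadditivity of the measure of `p⁻¹ S △ S` -/

section Subadditive

/-- In a finite group, `p ↦ |p⁻¹ S △ S|` is subadditive. -/
theorem ncard_translateDiffSet_mul_inv_le {A : Type*} [Group A] [Finite A] (S : Set A) (p q : A) :
    (translateDiffSet S (p * q⁻¹)).ncard ≤
      (translateDiffSet S p).ncard + (translateDiffSet S q).ncard := by
  -- Writing x = qy compares py ∈ S with qy ∈ S; if they differ, one of them differs from y ∈ S.
  have hsub : translateDiffSet S (p * q⁻¹) ⊆
      (fun x => q * x) '' (translateDiffSet S p ∪ translateDiffSet S q) := by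
    intro x hx
    refine ⟨q⁻¹ * x, ?_, by simp⟩
    simp only [translateDiffSet, Set.mem_ofPred_eq, Set.mem_union, mul_inv_cancel_left,
      mul_assoc] at hx ⊢
    tauto
  calc _ ≤ ((fun x => q * x) '' (translateDiffSet S p ∪ translateDiffSet S q)).ncard :=
        Set.ncard_le_ncard hsub (Set.toFinite _)
    _ ≤ (translateDiffSet S p ∪ translateDiffSet S q).ncard := Set.ncard_image_le (Set.toFinite _)
    _ ≤ _ := Set.ncard_union_le _ _

variable {L : FirstOrder.Language.{u, v}} [GroupLanguage L] {n : ℕ}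

/-- The `L⁺`-formula
`∀ z̄ x₀ x₁ x₂, x₂ x₁ = x₀ → μ_θ(z̄, x₀) ≤ w₀ → μ_θ(z̄, x₁) ≤ w₁ → μ_θ(z̄, x₂) ≤ w₂`. -/
def subadditiveFormula (θ : L.Formula (Fin 1 ⊕ Fin (n + 1))) : (plus L).Formula (Fin 3) :=
  let f (k : Fin 3) : Fin (n + 1) → Fin 3 ⊕ (Fin n ⊕ Fin 3) :=
    Fin.snoc (α := fun _ => Fin 3 ⊕ (Fin n ⊕ Fin 3)) (fun i => Sum.inr (Sum.inl i))
      (Sum.inr (Sum.inr k))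
  let t (k : Fin 3) : L.Term (Fin n ⊕ Fin 3) := Term.var (Sum.inr k)
  homeAlls (Fin n ⊕ Fin 3)
    ((Formula.relabel Sum.inr (relativize
      (Term.equal ((GroupLanguage.mulSym : L.Functions 2).apply₂ (t 2) (t 1)) (t 0)))).imp
      ((muLe θ (f 0) (Sum.inl 0)).imp ((muLe θ (f 1) (Sum.inl 1)).imp
        (muLe θ (f 2) (Sum.inl 2)))))

variable {G : Type*} [L.Structure G] [Group G] [CompatibleGroup L G] {J : Type*}
  [SecondSort L G J]

theorem realize_subadditiveFormula (θ : L.Formula (Fin 1 ⊕ Fin (n + 1))) (w : Fin 3 → G ⊕ J) :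
    (subadditiveFormula θ).Realize w ↔ ∀ (c : Fin n → G) (x : Fin 3 → G), x 2 * x 1 = x 0 →
      (¬ Structure.RelMap (ltSym L) ![w 0, Sum.inr
        (SecondSort.mu θ (Fin.snoc (α := fun _ => G) c (x 0)) : J)]) →
      (¬ Structure.RelMap (ltSym L) ![w 1, Sum.inr
        (SecondSort.mu θ (Fin.snoc (α := fun _ => G) c (x 1)) : J)]) →
      (¬ Structure.RelMap (ltSym L) ![w 2, Sum.inr
        (SecondSort.mu θ (Fin.snoc (α := fun _ => G) c (x 2)) : J)]) := by
  rw [subadditiveFormula, realize_homeAlls]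
  have hle : ∀ (c : Fin n → G) (x : Fin 3 → G) (k : Fin 3),
      (muLe θ (Fin.snoc (α := fun _ => Fin 3 ⊕ (Fin n ⊕ Fin 3)) (fun i => Sum.inr (Sum.inl i))
        (Sum.inr (Sum.inr k))) (Sum.inl k)).Realize
        (Sum.elim w fun b => Sum.inl (Sum.elim c x b)) ↔
      ¬ Structure.RelMap (ltSym L) ![w k, Sum.inr
        (SecondSort.mu θ (Fin.snoc (α := fun _ => G) c (x k)) : J)] := by
    intro c x k
    refine realize_muLe _ _ _ _ _ fun i => ?_
    refine Fin.lastCases ?_ (fun i => ?_) i <;> simp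
  have heq : ∀ (c : Fin n → G) (x : Fin 3 → G),
      (Formula.relabel (Sum.inr : _ → Fin 3 ⊕ (Fin n ⊕ Fin 3)) (relativize
        (Term.equal ((GroupLanguage.mulSym : L.Functions 2).apply₂ (Term.var (Sum.inr 2))
          (Term.var (Sum.inr 1))) (Term.var (Sum.inr 0))))).Realize
        (Sum.elim w fun b => Sum.inl (Sum.elim c x b)) ↔ x 2 * x 1 = x 0 := by
    intro c x
    rw [Formula.realize_relabel]
    refine (realize_relativize (J := J) _ (Sum.elim c x)).trans ?_
    rw [Formula.realize_equal, realize_mulSym]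
    rfl
  constructor
  · intro h c x
    have := h (Sum.elim c x)
    simp only [Formula.realize_imp, hle, heq] at this
    exact this
  · intro h a
    obtain ⟨c, x, rfl⟩ : ∃ c x, a = Sum.elim c x := ⟨_, _, (Sum.elim_comp_inl_inr a).symm⟩
    simp only [Formula.realize_imp, hle, heq]
    exact h c x

end Subadditive

/-! ### Separating tuples in the nonstandard group -/

section Separating

variable {L : FirstOrder.Language.{u, v}} [GroupLanguage L] {n : ℕ}

/-- The `L`-formula expressing that `φ^ℓ(x; c, y)` is `k`-NIP. -/
def nipFormula (φ : L.Formula (Fin 1 ⊕ Fin n)) (k : ℕ) : L.Formula (Fin n) :=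
  open Classical in
  let ψ (p : Fin k × Set (Fin k)) : L.Formula (Fin n ⊕ (Fin k ⊕ Set (Fin k))) :=
    substTerm φ ((GroupLanguage.mulSym : L.Functions 2).apply₂ (Term.var (Sum.inr (Sum.inr p.2)))
      (Term.var (Sum.inr (Sum.inl p.1)))) Sum.inl
  ∼ (Formula.iExs (Fin k ⊕ Set (Fin k))
    (Formula.iInf fun p : Fin k × Set (Fin k) => if p.1 ∈ p.2 then ψ p else ∼ (ψ p)))

/-- The `L`-formula `⋀_j (φ(u₀ u₁ x_j; c) ↔ φ(u₁ x_j; c))`. -/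
def sameTraceFormula (φ : L.Formula (Fin 1 ⊕ Fin n)) (N : ℕ) :
    L.Formula ((Fin n ⊕ Fin N) ⊕ Fin 2) :=
  let mul (t₁ t₂ : L.Term ((Fin n ⊕ Fin N) ⊕ Fin 2)) : L.Term ((Fin n ⊕ Fin N) ⊕ Fin 2) :=
    (GroupLanguage.mulSym : L.Functions 2).apply₂ t₁ t₂
  let x (j : Fin N) : L.Term ((Fin n ⊕ Fin N) ⊕ Fin 2) := Term.var (Sum.inl (Sum.inr j))
  let u (i : Fin 2) : L.Term ((Fin n ⊕ Fin N) ⊕ Fin 2) := Term.var (Sum.inr i)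
  Formula.iInf fun j : Fin N =>
    (substTerm φ (mul (mul (u 0) (u 1)) (x j)) (fun i => Sum.inl (Sum.inl i))).iff
      (substTerm φ (mul (u 1) (x j)) (fun i => Sum.inl (Sum.inl i)))

/-- The `L⁺`-formula expressing that, for all `c` such that `φ^ℓ(x; c, y)` is `k`-NIP, there is an
`N`-tuple `x` such that `μ_θ(c, u₀) ≤ w` whenever `u₀ u₁` and `u₁` have the same trace on `x`. -/
def separatingFormula (φ : L.Formula (Fin 1 ⊕ Fin n)) (k N : ℕ) : (plus L).Formula Unit :=
  homeAlls (Fin n) ((Formula.relabel Sum.inr (relativize (nipFormula φ k))).imp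
    (homeExs (Fin N) (homeAlls (Fin 2)
      ((Formula.relabel (Sum.map (Sum.map Sum.inr id) id)
          (relativize (sameTraceFormula φ N))).imp
        (muLe (translateDiff φ)
          (Fin.snoc (α := fun _ => ((Unit ⊕ Fin n) ⊕ Fin N) ⊕ Fin 2)
            (fun i => Sum.inl (Sum.inl (Sum.inr i))) (Sum.inr 0))
          (Sum.inl (Sum.inl (Sum.inl ()))))))))

variable {G : Type*} [L.Structure G] [Group G] [CompatibleGroup L G]

theorem binaryRel_formulaLeft (φ : L.Formula (Fin 1 ⊕ Fin n)) (c : Fin n → G) (x y : G) :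
    binaryRel (formulaLeft φ) c x y ↔ y * x ∈ solutionSet φ c :=
  realize_formulaLeft φ c (fun _ => x) y

theorem realize_nipFormula (φ : L.Formula (Fin 1 ⊕ Fin n)) (k : ℕ) (c : Fin n → G) :
    (nipFormula φ k).Realize c ↔ IsNIPWith (binaryRel (formulaLeft φ) c) k := by
  classical
  rw [nipFormula, Formula.realize_not, Formula.realize_iExs, IsNIPWith]
  refine not_congr ?_
  have key : ∀ (a : Fin k → G) (b : Set (Fin k) → G),
      (Formula.iInf fun p : Fin k × Set (Fin k) => if p.1 ∈ p.2 then
        (substTerm φ ((GroupLanguage.mulSym : L.Functions 2).apply₂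
          (Term.var (Sum.inr (Sum.inr p.2))) (Term.var (Sum.inr (Sum.inl p.1)))) Sum.inl :
          L.Formula (Fin n ⊕ (Fin k ⊕ Set (Fin k))))
        else ∼ (substTerm φ ((GroupLanguage.mulSym : L.Functions 2).apply₂
          (Term.var (Sum.inr (Sum.inr p.2)))
          (Term.var (Sum.inr (Sum.inl p.1)))) Sum.inl)).Realize (Sum.elim c (Sum.elim a b)) ↔
      ∀ i X, binaryRel (formulaLeft φ) c (a i) (b X) ↔ i ∈ X := by
    intro a b
    rw [Formula.realize_iInf, Prod.forall]
    refine forall_congr' fun i => forall_congr' fun X => ?_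
    rw [binaryRel_formulaLeft]
    split_ifs with h
    · rw [realize_substTerm, realize_mulSym]
      simp only [Term.realize_var, Sum.elim_inr, Sum.elim_inl, h, iff_true]
    · rw [Formula.realize_not, realize_substTerm, realize_mulSym]
      simp only [Term.realize_var, Sum.elim_inr, Sum.elim_inl, h, iff_false]
  constructor
  · rintro ⟨v, hv⟩
    obtain ⟨a, b, rfl⟩ : ∃ a b, v = Sum.elim a b := ⟨_, _, (Sum.elim_comp_inl_inr v).symm⟩
    exact ⟨a, b, (key a b).1 hv⟩
  · rintro ⟨a, b, h⟩
    exact ⟨Sum.elim a b, (key a b).2 h⟩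

theorem realize_sameTraceFormula (φ : L.Formula (Fin 1 ⊕ Fin n)) {N : ℕ} (c : Fin n → G)
    (x : Fin N → G) (u : Fin 2 → G) :
    (sameTraceFormula φ N).Realize (Sum.elim (Sum.elim c x) u) ↔
      ∀ j, u 0 * u 1 * x j ∈ solutionSet φ c ↔ u 1 * x j ∈ solutionSet φ c := by
  rw [sameTraceFormula, Formula.realize_iInf]
  refine forall_congr' fun j => ?_
  rw [Formula.realize_iff, realize_substTerm, realize_substTerm]
  simp only [realize_mulSym, Term.realize_var, Sum.elim_inr, Sum.elim_inl]

variable {J : Type*} [SecondSort L G J]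

theorem realize_separatingFormula (φ : L.Formula (Fin 1 ⊕ Fin n)) (k N : ℕ) (w : Unit → G ⊕ J) :
    (separatingFormula φ k N).Realize w ↔
      ∀ c : Fin n → G, IsNIPWith (binaryRel (formulaLeft φ) c) k →
        ∃ x : Fin N → G, ∀ u : Fin 2 → G,
          (∀ j, u 0 * u 1 * x j ∈ solutionSet φ c ↔ u 1 * x j ∈ solutionSet φ c) →
          ¬ Structure.RelMap (ltSym L) ![w (), Sum.inr
            (SecondSort.mu (translateDiff φ) (Fin.snoc (α := fun _ => G) c (u 0)) : J)] := by
  rw [separatingFormula, realize_homeAlls]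
  refine forall_congr' fun c => ?_
  rw [Formula.realize_imp, Formula.realize_relabel, realize_homeExs]
  refine imp_congr ?_ (exists_congr fun x => ?_)
  · exact (realize_relativize (J := J) _ c).trans (realize_nipFormula φ k c)
  rw [realize_homeAlls]
  refine forall_congr' fun u => ?_
  rw [Formula.realize_imp, Formula.realize_relabel]
  refine imp_congr ?_ ?_
  · refine Iff.trans (iff_of_eq (congrArg _ ?_))
      ((realize_relativize (J := J) _ (Sum.elim (Sum.elim c x) u)).trans
        (realize_sameTraceFormula φ c x u))
    funext i
    rcases i with (i | i) | i <;> rfl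
  · refine realize_muLe _ _ _ _ _ fun i => ?_
    refine Fin.lastCases ?_ (fun i => ?_) i <;> simp

end Separating

/-! ### The measure of `g⁻¹ S △ S` in the nonstandard group -/

section Main

variable {L : FirstOrder.Language.{u, v}} [GroupLanguage L] {ι : Type*} {U : Ultrafilter ι}
  {A : ι → Type*} [∀ i, L.Structure (A i)] [∀ i, Group (A i)] [∀ i, CompatibleGroup L (A i)]
  [∀ i, Finite (A i)]
  {G : Type*} [L.Structure G] [Group G] [CompatibleGroup L G] {J : Type*} [SecondSort L G J]
  (e : ((U : Filter ι).Product fun i => A i ⊕ unitInterval) ↪ₑ[plus L] (G ⊕ J))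
  {n : ℕ} (φ : L.Formula (Fin 1 ⊕ Fin n)) (c : Fin n → G)

theorem not_lt_mu_translateDiff_iff {A : Type*} [L.Structure A] [Group A] [CompatibleGroup L A]
    [Finite A] (φ : L.Formula (Fin 1 ⊕ Fin n)) (c : Fin n → A) (p : A) (r : unitInterval) :
    (¬ Structure.RelMap (ltSym L) ![(Sum.inr r : A ⊕ unitInterval),
      Sum.inr ((finiteSecondSort L A).mu (translateDiff φ) (Fin.snoc (α := fun _ => A) c p))]) ↔
      ((translateDiffSet (solutionSet φ c) p).ncard : ℝ) ≤ r * Nat.card A := by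
  rw [relMap_lt_finite, not_lt, mu_translateDiff_le_iff]

/-- The finite count is transferred for standard bounds r + s = t, with slack δ/2 on each summand to
make the bounds strict. -/
theorem measure_translateDiff_mul_inv_le (p q : G) :
    measure e (translateDiff φ) (Fin.snoc (α := fun _ => G) c (p * q⁻¹)) ≤
      measure e (translateDiff φ) (Fin.snoc (α := fun _ => G) c p) +
        measure e (translateDiff φ) (Fin.snoc (α := fun _ => G) c q) := by
  have hstd : ∀ r s t : unitInterval, (t : ℝ) = r + s →
      (subadditiveFormula (translateDiff φ)).Realize
        fun k => standardPoint e ((![r, s, t] : Fin 3 → unitInterval) k) := by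
    intro r s t hrst
    refine realize_standardPoint e _ _ fun i => ?_
    rw [realize_subadditiveFormula]
    intro c x hx h0 h1
    have h0' := (not_lt_mu_translateDiff_iff φ c (x 0) r).1 h0
    have h1' := (not_lt_mu_translateDiff_iff φ c (x 1) s).1 h1
    refine (not_lt_mu_translateDiff_iff φ c (x 2) t).2 ?_
    have h2 := ncard_translateDiffSet_mul_inv_le (solutionSet φ c) (x 0) (x 1)
    rw [← hx, mul_inv_cancel_right, hx] at h2
    have h2' : ((translateDiffSet (solutionSet φ c) (x 2)).ncard : ℝ) ≤
      (translateDiffSet (solutionSet φ c) (x 0)).ncard +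
        (translateDiffSet (solutionSet φ c) (x 1)).ncard := by exact_mod_cast h2
    rw [hrst, add_mul]
    linarith
  refine le_of_forall_pos_le_add fun δ hδ => ?_
  set P := measure e (translateDiff φ) (Fin.snoc (α := fun _ => G) c p) with hP
  set Q := measure e (translateDiff φ) (Fin.snoc (α := fun _ => G) c q) with hQ
  -- Past 1 the bound is trivial; otherwise the three bounds lie in [0,1] and name standard points.
  rcases le_or_gt 1 (P + Q + δ) with h1 | h1
  · exact (standardPart_le_one e _).trans h1
  have hP0 : 0 ≤ P := standardPart_nonneg e _
  have hQ0 : 0 ≤ Q := standardPart_nonneg e _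
  let r : unitInterval := ⟨P + δ / 2, by linarith, by linarith⟩
  let s : unitInterval := ⟨Q + δ / 2, by linarith, by linarith⟩
  let t : unitInterval := ⟨P + Q + δ, by linarith, by linarith⟩
  have h := (realize_subadditiveFormula _ _).1
    (hstd r s t (by simp only [r, s, t]; ring)) c ![p, q, p * q⁻¹] (by simp)
    (not_lt_of_standardPart_lt e _ (show P < P + δ / 2 by linarith))
    (not_lt_of_standardPart_lt e _ (show Q < Q + δ / 2 by linarith))
  exact standardPart_le e _ h

theorem exists_finset_measure_translateDiff_le
    (hNIP : IsNIP (binaryRel (formulaLeft φ) c)) {η : ℝ} (hη : 0 < η) :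
    ∃ F : Finset G, ∀ g h, (∀ x ∈ F, g * x ∈ solutionSet φ c ↔ h * x ∈ solutionSet φ c) →
      measure e (translateDiff φ) (Fin.snoc (α := fun _ => G) c (g * h⁻¹)) ≤ η := by
  classical
  obtain ⟨k, -, hk⟩ := hNIP
  -- Truncation at 1 makes the bound a standard point.
  let r : unitInterval := ⟨min η 1, by positivity, min_le_right _ _⟩
  have hr : 0 < (r : ℝ) := lt_min hη one_pos
  obtain ⟨N, hN⟩ := exists_separating_tuple k hr
  have hstd : (separatingFormula φ k N).Realize fun _ => standardPoint e r := by
    refine realize_standardPoint e _ (fun _ => r) fun i => ?_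
    rw [realize_separatingFormula]
    intro c hc
    have := Fintype.ofFinite (A i)
    obtain ⟨x, hx⟩ := hN (A i) (A i) _ hc
    refine ⟨x, fun u hu => (not_lt_mu_translateDiff_iff φ c (u 0) r).2 ?_⟩
    have h := hx (u 0 * u 1) (u 1) fun j => by
      simpa only [binaryRel_formulaLeft] using hu j
    rw [Nat.card_eq_fintype_card]
    refine le_trans (le_of_eq (congrArg _ ?_)) h
    -- The net bounds the set where `u 0 * u 1` and `u 1` disagree; left multiplication by `u 1`
    -- carries it onto the set to be measured.
    have himg : translateDiffSet (solutionSet φ c) (u 0) = (fun a => u 1 * a) ''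
        {a | binaryRel (formulaLeft φ) c a (u 0 * u 1) ∧ ¬ binaryRel (formulaLeft φ) c a (u 1) ∨
          binaryRel (formulaLeft φ) c a (u 1) ∧ ¬ binaryRel (formulaLeft φ) c a (u 0 * u 1)} := by
      ext a
      simp only [translateDiffSet, binaryRel_formulaLeft, Set.mem_image, Set.mem_ofPred_eq]
      constructor
      · intro ha
        exact ⟨(u 1)⁻¹ * a, by simpa [mul_assoc] using ha, by simp⟩
      · rintro ⟨b, hb, rfl⟩
        simpa [mul_assoc] using hb
    rw [himg, Set.ncard_image_of_injective _ (mul_right_injective (u 1))]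
  obtain ⟨x, hx⟩ := (realize_separatingFormula φ k N _).1 hstd c hk
  refine ⟨Finset.univ.image x, fun g h hgh => ?_⟩
  refine (standardPart_le e _ (hx ![g * h⁻¹, h] fun j => ?_)).trans (min_le_left _ _)
  simpa using hgh (x j) (Finset.mem_image_of_mem x (Finset.mem_univ j))

end Main

end PseudofiniteGroup

end

theorem proposition3p2 {L : FirstOrder.Language.{u, v}} [PseudofiniteGroup.GroupLanguage L]
    {ι : Type*} (U : Ultrafilter ι) (A : ι → Type*)
    [∀ i, L.Structure (A i)] [∀ i, Group (A i)] [∀ i, PseudofiniteGroup.CompatibleGroup L (A i)]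
    [∀ i, Finite (A i)]
    {G : Type*} [L.Structure G] [Group G] [PseudofiniteGroup.CompatibleGroup L G]
    {J : Type*} [PseudofiniteGroup.SecondSort L G J]
    (e : ((U : Filter ι).Product fun i => A i ⊕ unitInterval)
      ↪ₑ[PseudofiniteGroup.plus L] (G ⊕ J))
    {n : ℕ} (φ : L.Formula (Fin 1 ⊕ Fin n)) (c : Fin n → G)
    (hNIP : PseudofiniteGroup.IsNIP
      (PseudofiniteGroup.binaryRel (PseudofiniteGroup.formulaLeft φ) c)) :
    (∀ ε : ℝ, 0 < ε →
      PseudofiniteGroup.LeftGeneric (PseudofiniteGroup.stab e φ c ε) ∧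
      ∃ B : Set G, B.Countable ∧ PseudofiniteGroup.TypeDefinableBy
        (PseudofiniteGroup.binaryRel (PseudofiniteGroup.formulaRight φ) c) B
        (PseudofiniteGroup.stab e φ c ε)) ∧
    ∃ H : Subgroup G, (H : Set G) = PseudofiniteGroup.stab e φ c 0 ∧
      #(G ⧸ H) ≤ 𝔠 ∧
      ∃ B : Set G, B.Countable ∧ PseudofiniteGroup.TypeDefinableBy
        (PseudofiniteGroup.binaryRel (PseudofiniteGroup.formulaRight φ) c) B (H : Set G) := by
  obtain ⟨ν, hν⟩ : ∃ ν : G → ℝ, ∀ g, ν g =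
      PseudofiniteGroup.measure e (PseudofiniteGroup.translateDiff φ)
        (Fin.snoc (α := fun _ => G) c g) := ⟨_, fun _ => rfl⟩
  have h0 : ∀ g, 0 ≤ ν g := fun g => (hν g).symm ▸ PseudofiniteGroup.standardPart_nonneg e _
  have hsub : ∀ p q, ν (p * q⁻¹) ≤ ν p + ν q := fun p q => by
    simpa only [hν] using PseudofiniteGroup.measure_translateDiff_mul_inv_le e φ c p q
  have hnet : ∀ η : ℝ, 0 < η → ∃ F : Finset G, ∀ g h,
      (∀ x ∈ F, g * x ∈ PseudofiniteGroup.solutionSet φ c ↔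
        h * x ∈ PseudofiniteGroup.solutionSet φ c) → ν (g * h⁻¹) ≤ η := fun η hη => by
    simpa only [hν] using PseudofiniteGroup.exists_finset_measure_translateDiff_le e φ c hNIP hη
  have h1 := PseudofiniteGroup.map_one_eq_zero_of_separating h0 hnet
  -- The stabilizer is defined through `g⁻¹`; symmetry of `ν` removes the inverse.
  have hstab : ∀ ε, PseudofiniteGroup.stab e φ c ε = {g | ν g ≤ ε} := fun ε => by
    ext g
    rw [Set.mem_ofPred_eq, ← PseudofiniteGroup.map_inv_eq_of_subadditive h1 hsub g, hν]
    rfl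
  have hR : PseudofiniteGroup.binaryRel (PseudofiniteGroup.formulaRight φ) c =
      fun x y => x * y ∈ PseudofiniteGroup.solutionSet φ c :=
    funext fun x => funext fun y =>
      propext (PseudofiniteGroup.realize_formulaRight φ c (fun _ => x) y)
  have hgen := fun (ε : ℝ) (hε : 0 < ε) => PseudofiniteGroup.leftGeneric_sublevel hnet hε
  have hdef := PseudofiniteGroup.typeDefinableBy_sublevel h1 hsub hnet
  simp only [hstab, hR]
  exact ⟨fun ε hε => ⟨hgen ε hε, hdef ε⟩, PseudofiniteGroup.zeroSubgroup h1 hsub, rfl,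
    PseudofiniteGroup.mk_quotient_le_continuum rfl h1 hsub hgen, hdef 0⟩
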